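/- Let $m\ge 1$ be an integer, $q=3^m$, and let $\alpha$ be a primitive element (a generator of the multiplicative group) of the finite field $\mathbb{F}_{q^2}$. Let $p(x)=p_1(x)p_2(x)$, where $p_1$ and $p_2$ are the minimal polynomials over $\mathbb{F}_3$ of $\alpha^{-1}$ and $\alpha^{-(q+2)}$, respectively. Then $p(x)$ divides $x^{q^2-1}-1$, so there is a unique ternary cyclic code $\mathcal{C}\subseteq\mathbb{F}_3^{\,q^2-1}$ with parity-check polynomial $p(x)$, namely the set of words $(c_0,\dots,c_{q^2-2})$ for which $\sum_i c_ix^i$ lies in the ideal of $\mathbb{F}_3[x]/(x^{q^2-1}-1)$ generated by $g(x)=(x^{q^2-1}-1)/p(x)$. The code $\mathcal{C}$ has parameters $\left[q^2-1,\,4m,\,\frac{2q(q-2)}{3}\right]$, that is, length $q^2-1$, dimension $4m$ over $\mathbb{F}_3$ and minimum Hamming distance $\frac{2q(q-2)}{3}$. It has exactly four distinct nonzero Hamming weights, and its weight distribution is as follows: - weight $0$ occurs $1$ time; - weight $\frac{2q(q-2)}{3}$ occurs $\frac{q^4-q^3-q^2+q}{6}$ times; - weight $\frac{2q(q-1)}{3}$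 occurs $q^3-q$ times; - weight $\frac{2q^2}{3}$ occurs $\frac{q^4-q^3+q^2+q}{2}-1$ times; - weight $\frac{2q(q+1)}{3}$ occurs $\frac{q^4-q^3-q^2+q}{3}$ times; and no other weight occurs. -/

import Mathlib

open Polynomial

namespace CyclicCodes

variable {K : Type*} [Field K] {n : ℕ}

/-- The polynomial `c₀ + c₁ x + ⋯ + cₙ₋₁ xⁿ⁻¹` of a word `c`. -/
noncomputable def wordPoly (c : Fin n → K) : K[X] :=
  ∑ i : Fin n, C (c i) * X ^ (i : ℕ)

/-- The ring `K[x] / (xⁿ - 1)`. -/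
abbrev CyclicRing (K : Type*) [Field K] (n : ℕ) : Type _ :=
  K[X] ⧸ Ideal.span {(X ^ n - 1 : K[X])}

/-- The class of the polynomial of a word in `K[x] / (xⁿ - 1)`. -/
noncomputable def wordClass (c : Fin n → K) : CyclicRing K n :=
  Ideal.Quotient.mk (Ideal.span {(X ^ n - 1 : K[X])}) (wordPoly c)

/-- The code `⟨g⟩` of length `n`: the words whose class lies in the principal ideal of
`K[x] / (xⁿ - 1)` generated by `g`. -/
noncomputable def codeOfGenerator (n : ℕ) (g : K[X]) : Submodule K (Fin n → K) where
  carrier := {c | wordClass c ∈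
    Ideal.span {Ideal.Quotient.mk (Ideal.span {(X ^ n - 1 : K[X])}) g}}
  zero_mem' := by simp [wordClass, wordPoly]
  add_mem' := by
    intro a b ha hb
    have h : wordClass (a + b) = wordClass a + wordClass b := by
      simp [wordClass, wordPoly, add_mul, Finset.sum_add_distrib]
    simp only [Set.mem_ofPred_eq] at ha hb ⊢
    rw [h]
    exact Ideal.add_mem _ ha hb
  smul_mem' := by
    intro r a ha
    have h : wordClass (r • a) =
        Ideal.Quotient.mk (Ideal.span {(X ^ n - 1 : K[X])}) (C r) * wordClass a := by
      rw [wordClass, wordClass, ← map_mul]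
      simp [wordPoly, mul_assoc, Finset.mul_sum]
    simp only [Set.mem_ofPred_eq] at ha ⊢
    rw [h]
    exact Ideal.mul_mem_left _ _ ha

/-- `code` is the cyclic code with parity-check polynomial `h`: it is `⟨g⟩` for a monic `g`
dividing `xⁿ - 1`, and `h = (xⁿ - 1) / g`. -/
def HasParityCheckPolynomial (code : Submodule K (Fin n → K)) (h : K[X]) : Prop :=
  ∃ g : K[X], g.Monic ∧ g * h = X ^ n - 1 ∧ code = codeOfGenerator n g

/-- Invariance under `(c₀, c₁, …, cₙ₋₁) ↦ (cₙ₋₁, c₀, …, cₙ₋₂)`. -/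
def IsCyclicCode (code : Submodule K (Fin n → K)) : Prop :=
  ∀ c ∈ code, (fun i => c ((finRotate n).symm i)) ∈ code

/-- A linear code of length `n` with parameters `[n, k, d]`: dimension `k` and minimum
Hamming distance `d`. -/
def HasParameters [DecidableEq K] (code : Submodule K (Fin n → K)) (k d : ℕ) : Prop :=
  Module.finrank K code = k ∧
    IsLeast {e : ℕ | ∃ x ∈ code, ∃ y ∈ code, x ≠ y ∧ hammingDist x y = e} d

/-- The set of weights of the nonzero codewords. -/
def nonzeroWeights [DecidableEq K] (code : Submodule K (Fin n → K)) : Set ℕ :=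
  {w | ∃ c ∈ code, c ≠ 0 ∧ hammingNorm c = w}

/-- The number of codewords of Hamming weight `w`. -/
noncomputable def weightCount [DecidableEq K] (code : Submodule K (Fin n → K)) (w : ℕ) : ℕ :=
  Set.ncard {c : Fin n → K | c ∈ code ∧ hammingNorm c = w}

end CyclicCodes

/-! The code is the set of words `Tr (a αⁱ + b α^((q+2)i))` with `a, b` in `F`. Since `q + 2 ≡ 3`
modulo `q - 1`, the exponent is of Niho type. Write `αⁱ = z y` with `z = αʲ`, `0 ≤ j ≤ q`, and `y`
in the multiplicative group of the subfield `K` of order `q`. The absolute trace is invariant under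
cubing, so on the `j`-th coset the word reads `Tr_K (t y³)` with `t = cosetTrace K q α j (a, b)`.
Cubing permutes `K`, so the coset contributes `2q/3` to the weight if `t ≠ 0` and nothing otherwise
(`hammingNorm_traceWord`).

Up to the factor `z³`, `t` is the value at `u = z^(q-1)` of a polynomial of degree at most 3 whose
coefficients determine `(a, b)`. The `q + 1` values of `u` are distinct, so any four of the `t`
determine `(a, b)`, as in an MDS code of dimension 4 (`cosetTrace_injective`). A nonzero pair thus
has at most three zeros, and the binomial moments of the zero count fix its distribution
(`card_zeros_distribution`).

The trace words lie in the code because `p` annihilates them. Positivity of the weights makes the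
parametrization injective, so they span dimension `4m`, while the code has dimension at most `deg p
≤ 4m`. -/

namespace CyclicCodes

/-! ### Zero counts in MDS-type families. -/

open Finset in
/-- For functions whose restrictions to any `d` points of `J` determine `v`, the number of `v`
vanishing on a `k`-subset of `J` is `|K| ^ (d - k)`. -/
theorem card_vanishing_of_interpolation {J V K : Type*} [Fintype J] [DecidableEq J] [Fintype V]
    [Fintype K] [DecidableEq K] [Zero K] (L : J → V → K) (d : ℕ) (hJ : d ≤ Fintype.card J)
    (hV : Fintype.card V = Fintype.card K ^ d)
    (hL : ∀ S : Finset J, #S = d → Function.Injective fun (v : V) (j : S) => L j v)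
    (S : Finset J) (hS : #S ≤ d) :
    #{v | ∀ j ∈ S, L j v = 0} = Fintype.card K ^ (d - #S) := by
  -- After enlarging `S` to `d` points, restriction to `T` is injective between sets of equal size,
  -- so the values on `T` can be prescribed freely.
  obtain ⟨T, hST, hT⟩ := Finset.exists_superset_card_eq hS hJ
  have hbij : Function.Bijective fun (v : V) (j : T) => L j v := by
    rw [Fintype.bijective_iff_injective_and_card]
    exact ⟨hL T hT, by simp [hV, hT]⟩
  have h1 : #{v | ∀ j ∈ S, L j v = 0} =
      #(Fintype.piFinset fun j : T => if (j : J) ∈ S then ({0} : Finset K) else univ) := by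
    refine Finset.card_bij (fun v _ (j : T) => L j v) ?_ (fun v _ w _ h => hbij.1 h) ?_
    · intro v hv
      simp only [mem_filter, mem_univ, true_and] at hv
      simp only [Fintype.mem_piFinset]
      intro j
      split_ifs with h
      · simpa using hv _ h
      · simp
    · intro f hf
      obtain ⟨v, hv⟩ := hbij.2 f
      refine ⟨v, ?_, hv⟩
      simp only [Fintype.mem_piFinset] at hf
      simp only [mem_filter, mem_univ, true_and]
      intro j hj
      have := hf ⟨j, hST hj⟩
      simp only [hj, if_true, mem_singleton] at this
      rw [← this, ← hv]
  rw [h1, Fintype.card_piFinset]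
  have h2 : ∀ j : T, #(if (j : J) ∈ S then ({0} : Finset K) else univ) =
      if (j : J) ∈ S then 1 else Fintype.card K := by
    intro j; split_ifs <;> simp
  simp only [h2]
  rw [Finset.prod_coe_sort T (fun j => if j ∈ S then 1 else Fintype.card K),
    Finset.prod_ite, Finset.prod_const_one, one_mul, Finset.prod_const,
    ← Finset.sdiff_eq_filter, Finset.card_sdiff_of_subset hST, hT]

open Finset in
/-- The binomial moments of the number of zeros. -/
theorem sum_choose_card_zeros {J V K : Type*} [Fintype J] [DecidableEq J] [Fintype V]
    [Fintype K] [DecidableEq K] [Zero K] (L : J → V → K) (d : ℕ) (hJ : d ≤ Fintype.card J)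
    (hV : Fintype.card V = Fintype.card K ^ d)
    (hL : ∀ S : Finset J, #S = d → Function.Injective fun (v : V) (j : S) => L j v)
    (k : ℕ) (hk : k ≤ d) :
    ∑ v, (#{j | L j v = 0}).choose k = (Fintype.card J).choose k * Fintype.card K ^ (d - k) := by
  have h1 : ∀ v, (#{j | L j v = 0}).choose k =
      ∑ S ∈ powersetCard k (univ : Finset J), if (∀ j ∈ S, L j v = 0) then 1 else 0 := by
    intro v
    rw [← card_powersetCard, ← Finset.card_filter]
    congr 1
    ext S
    simp [mem_powersetCard, subset_iff, and_comm]
  simp only [h1]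
  rw [sum_comm]
  have h2 : ∀ S ∈ powersetCard k (univ : Finset J),
      (∑ v : V, if (∀ j ∈ S, L j v = 0) then 1 else 0) = Fintype.card K ^ (d - k) := by
    intro S hS
    rw [mem_powersetCard] at hS
    rw [← Finset.card_filter, card_vanishing_of_interpolation L d hJ hV hL S (by omega), hS.2]
  rw [sum_congr rfl h2, sum_const, card_powersetCard, card_univ, smul_eq_mul]

open Finset in
/-- The distribution of the number of zeros for a family of `q + 1` functions, any four of which
determine the point. -/
theorem card_zeros_distribution {J V K : Type*} [Fintype J] [DecidableEq J] [Fintype V]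
    [DecidableEq V]
    [Fintype K] [DecidableEq K] [Zero K] (L : J → V → K) (q : ℕ) (hq : 3 ≤ q)
    (hK : Fintype.card K = q) (hJ : Fintype.card J = q + 1)
    (hV : Fintype.card V = q ^ 4)
    (hL : ∀ S : Finset J, #S = 4 → Function.Injective fun (v : V) (j : S) => L j v)
    (v₀ : V) (hv₀ : ∀ j, L j v₀ = 0) :
    (∀ v, v ≠ v₀ → #{j | L j v = 0} ≤ 3) ∧
    (#{v | #{j | L j v = 0} = 3} : ℚ) = ((q : ℚ) ^ 4 - q ^ 3 - q ^ 2 + q) / 6 ∧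
    (#{v | #{j | L j v = 0} = 2} : ℚ) = (q : ℚ) ^ 3 - q ∧
    (#{v | #{j | L j v = 0} = 1} : ℚ) = ((q : ℚ) ^ 4 - q ^ 3 + q ^ 2 + q) / 2 - 1 ∧
    (#{v | #{j | L j v = 0} = 0} : ℚ) = ((q : ℚ) ^ 4 - q ^ 3 - q ^ 2 + q) / 3 := by
  have hle : ∀ v, v ≠ v₀ → #{j | L j v = 0} ≤ 3 := by
    intro v hv
    by_contra! h
    obtain ⟨S, hS, hS4⟩ := Finset.exists_subset_card_eq (show 4 ≤ _ from h)
    refine hv (hL S hS4 (funext fun j => ?_))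
    have := hS j.2
    simp only [mem_filter, mem_univ, true_and] at this
    simp [this, hv₀]
  -- Since `q + 1 ≥ 4`, `v₀` falls in none of the four classes counted; its contribution to each
  -- moment is separated below.
  have h0 : #{j | L j v₀ = 0} = q + 1 := by simp [hv₀, hJ]
  have hmom : ∀ k ≤ 4, (((q + 1).choose k : ℕ) : ℚ) +
      ((Nat.choose 0 k : ℕ) * #{v | #{j | L j v = 0} = 0} + (Nat.choose 1 k : ℕ) * #{v | #{j | L j v = 0} = 1}
      + (Nat.choose 2 k : ℕ) * #{v | #{j | L j v = 0} = 2}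
      + (Nat.choose 3 k : ℕ) * #{v | #{j | L j v = 0} = 3}) = (((q + 1).choose k : ℕ) : ℚ) * q ^ (4 - k) := by
    intro k hk
    have := sum_choose_card_zeros L 4 (by omega) (by rw [hV, hK]) hL k hk
    rw [hJ, hK] at this
    have h := this
    rw [← Finset.add_sum_erase univ _ (mem_univ v₀), h0] at h
    have h3 : ∀ v ∈ univ.erase v₀, (#{j | L j v = 0}).choose k =
        ∑ i ∈ range 4, if #{j | L j v = 0} = i then i.choose k else 0 := by
      intro v hv
      have := hle v (ne_of_mem_erase hv)
      rw [Finset.sum_ite_eq, if_pos (mem_range.2 (by omega))]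
    rw [sum_congr rfl h3, sum_comm] at h
    have h4 : ∀ i ∈ range 4, (∑ v ∈ univ.erase v₀, if #{j | L j v = 0} = i then i.choose k else 0)
        = i.choose k * #{v | #{j | L j v = 0} = i} := by
      intro i hi
      rw [mem_range] at hi
      rw [← Finset.sum_filter, sum_const, smul_eq_mul, mul_comm]
      congr 2
      ext v
      simp only [mem_filter, mem_erase, mem_univ, true_and, and_true]
      refine ⟨fun h => h.2, fun h => ⟨?_, h⟩⟩
      rintro rfl
      omega
    rw [sum_congr rfl h4] at h
    simp only [sum_range_succ, sum_range_zero] at h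
    have h5 := congrArg (Nat.cast : ℕ → ℚ) h
    push_cast at h5
    linarith
  have c2 : (((q + 1).choose 2 : ℕ) : ℚ) = (q + 1) * q / 2 := by
    rw [Nat.cast_choose_two]; push_cast; ring
  have c3 : (((q + 1).choose 3 : ℕ) : ℚ) = (q + 1) * q * (q - 1) / 6 := by
    have e1 := congrArg (Nat.cast : ℕ → ℚ) (Nat.choose_succ_right_eq (q + 1) 2)
    rw [Nat.cast_mul, Nat.cast_mul, c2, Nat.cast_sub (by omega)] at e1
    push_cast at e1
    linarith
  have m0 := hmom 0 (by norm_num)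
  have m1 := hmom 1 (by norm_num)
  have m2 := hmom 2 (by norm_num)
  have m3 := hmom 3 (by norm_num)
  rw [c2] at m2
  rw [c3] at m3
  -- The moments `k = 0, 1, 2, 3` form a triangular linear system in the four unknown counts.
  norm_num [Nat.choose, -Finset.card_eq_zero] at m0 m1 m2 m3
  refine ⟨hle, ?_, ?_, ?_, ?_⟩ <;> linarith

/-! ### Cyclic codes and their generators. -/

section Generator

variable {K : Type*} [Field K] {n : ℕ}

theorem coeff_wordPoly (c : Fin n → K) (i : Fin n) : (wordPoly c).coeff i = c i := by
  simp [wordPoly, finsetSum_coeff, coeff_C_mul, coeff_X_pow, Fin.val_inj]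

theorem degree_wordPoly_lt (c : Fin n → K) : (wordPoly c).degree < n := by
  rw [wordPoly, degree_lt_iff_coeff_zero]
  intro k hk
  rw [finsetSum_coeff]
  refine Finset.sum_eq_zero fun i _ => ?_
  rw [coeff_C_mul, coeff_X_pow, if_neg (by omega), mul_zero]

theorem wordPoly_coeff_eq (f : K[X]) (hf : f.degree < n) :
    wordPoly (fun i : Fin n => f.coeff i) = f := by
  ext i
  by_cases hi : i < n
  · exact coeff_wordPoly (fun i : Fin n => f.coeff i) ⟨i, hi⟩
  · have hi : (n : WithBot ℕ) ≤ i := by exact_mod_cast not_lt.1 hi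
    rw [coeff_eq_zero_of_degree_lt ((degree_wordPoly_lt _).trans_le hi),
      coeff_eq_zero_of_degree_lt (hf.trans_le hi)]

theorem mem_codeOfGenerator_iff {g : K[X]} (hg : g ∣ X ^ n - 1) (c : Fin n → K) :
    c ∈ codeOfGenerator n g ↔ g ∣ wordPoly c := by
  change Ideal.Quotient.mk _ (wordPoly c) ∈ Ideal.span {Ideal.Quotient.mk _ g} ↔ _
  rw [Ideal.mem_span_singleton]
  constructor
  · rintro ⟨r, hr⟩
    obtain ⟨r, rfl⟩ := Ideal.Quotient.mk_surjective r
    rw [← map_mul, Ideal.Quotient.eq, Ideal.mem_span_singleton] at hr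
    have := (hg.trans hr).add (dvd_mul_right g r)
    simpa using this
  · exact fun h => map_dvd _ h

theorem mem_codeOfGenerator_iff_dvd_mul {g h : K[X]} (hgh : g * h = X ^ n - 1) (hh : h ≠ 0)
    (c : Fin n → K) : c ∈ codeOfGenerator n g ↔ X ^ n - 1 ∣ wordPoly c * h := by
  rw [mem_codeOfGenerator_iff ⟨h, hgh.symm⟩, ← hgh, mul_dvd_mul_iff_right hh]

/-- The linear map sending the coefficients of `f` to those of `g * f`. -/
noncomputable def mulGenerator (n d : ℕ) (g : K[X]) : (Fin d → K) →ₗ[K] (Fin n → K) where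
  toFun v i := (g * wordPoly v).coeff i
  map_add' v w := by
    ext i
    simp [wordPoly, add_mul, Finset.sum_add_distrib, mul_add]
  map_smul' r v := by
    ext i
    simp only [wordPoly, Pi.smul_apply, smul_eq_mul, map_mul, RingHom.id_apply, mul_assoc,
      ← Finset.mul_sum]
    rw [mul_left_comm, coeff_C_mul]

/-- Every codeword is `g * f` with `deg f < deg h`. The upper bound suffices, as the trace words
supply the lower one. -/
theorem finrank_codeOfGenerator_le (hn : 0 < n) {g h : K[X]} (hgh : g * h = X ^ n - 1) :
    Module.finrank K (codeOfGenerator n g) ≤ h.natDegree := by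
  have hne : (X ^ n - 1 : K[X]) ≠ 0 := X_pow_sub_C_ne_zero hn 1
  have hg : g ≠ 0 := by rintro rfl; exact hne (by rw [← hgh, zero_mul])
  have hh : h ≠ 0 := by rintro rfl; exact hne (by rw [← hgh, mul_zero])
  have hdeg : g.natDegree + h.natDegree = n := by
    rw [← natDegree_mul hg hh, hgh]
    exact natDegree_X_pow_sub_C (r := (1 : K))
  have hle : codeOfGenerator n g ≤ LinearMap.range (mulGenerator n h.natDegree g) := by
    intro c hc
    rw [mem_codeOfGenerator_iff ⟨h, hgh.symm⟩] at hc
    obtain ⟨f, hf⟩ := hc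
    have hfd : f.degree < h.natDegree := by
      by_cases hf0 : f = 0
      · simp [hf0]
      · have := degree_wordPoly_lt c
        rw [hf, ← natDegree_lt_iff_degree_lt (mul_ne_zero hg hf0), natDegree_mul hg hf0] at this
        rw [← natDegree_lt_iff_degree_lt hf0]
        omega
    refine ⟨fun i => f.coeff i, funext fun i => ?_⟩
    change (g * wordPoly _).coeff i = _
    rw [wordPoly_coeff_eq f hfd, ← hf, coeff_wordPoly]
  calc _ ≤ Module.finrank K (LinearMap.range (mulGenerator n h.natDegree g)) :=
        Submodule.finrank_mono hle
    _ ≤ Module.finrank K (Fin h.natDegree → K) := LinearMap.finrank_range_le _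
    _ = _ := by simp

theorem existsUnique_hasParityCheckPolynomial (hn : 0 < n) {h : K[X]} (hm : h.Monic)
    (hd : h ∣ X ^ n - 1) :
    ∃! code : Submodule K (Fin n → K), HasParityCheckPolynomial code h := by
  obtain ⟨g, hg⟩ := hd
  have hgm : g.Monic := by
    have hX : (h * g).Monic := hg ▸ monic_X_pow_sub_C (1 : K) hn.ne'
    exact hm.of_mul_monic_left hX
  refine ⟨codeOfGenerator n g, ⟨g, hgm, by rw [mul_comm, hg], rfl⟩, ?_⟩
  rintro code ⟨g', -, hg', rfl⟩
  have : g' = g := mul_right_cancel₀ hm.ne_zero (by rw [hg', hg, mul_comm])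
  rw [this]

end Generator

/-! ### Trace words and the parity-check polynomial. -/

section Trace

variable {k F : Type*} [Field k] [Field F] [Algebra k F]

/-- The words `(Tr (a γⁱ + b δⁱ))ᵢ`. -/
noncomputable def traceWord (k : Type*) [Field k] [Algebra k F] (n : ℕ) (γ δ : Fˣ) :
    F × F →ₗ[k] (Fin n → k) where
  toFun v i := Algebra.trace k F (v.1 * (γ : F) ^ (i : ℕ) + v.2 * (δ : F) ^ (i : ℕ))
  map_add' v w := by
    ext i
    simp only [Prod.fst_add, Prod.snd_add, Pi.add_apply, ← map_add]
    congr 1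
    ring
  map_smul' r v := by
    ext i
    simp [mul_add]

theorem traceWord_apply (n : ℕ) (γ δ : Fˣ) (v : F × F) (i : Fin n) : traceWord k n γ δ v i =
    Algebra.trace k F (v.1 * (γ : F) ^ (i : ℕ) + v.2 * (δ : F) ^ (i : ℕ)) := rfl

theorem isCyclicCode_range_traceWord {n : ℕ} (hn : n = Nat.card F - 1) (γ δ : Fˣ) :
    IsCyclicCode (LinearMap.range (traceWord k n γ δ)) := by
  rintro _ ⟨v, rfl⟩
  refine ⟨(v.1 * ((γ⁻¹ : Fˣ) : F), v.2 * ((δ⁻¹ : Fˣ) : F)), funext fun i => ?_⟩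
  have hpow : ∀ η : Fˣ, ((η⁻¹ : Fˣ) : F) * (η : F) ^ (i : ℕ) =
      (η : F) ^ (((finRotate n).symm i : Fin n) : ℕ) := by
    intro η
    obtain ⟨j, rfl⟩ := (finRotate n).surjective i
    rw [Equiv.symm_apply_apply]
    have hη : η ^ n = 1 := by
      rw [hn, ← Nat.card_units]
      exact pow_card_eq_one'
    -- At the wrap-around from the last index to `0`, this uses `η ^ n = 1`.
    have hs : η ^ ((finRotate n j : Fin n) : ℕ) = η ^ ((j : ℕ) + 1) := by
      obtain _ | n := n
      · exact j.elim0
      · rw [coe_finRotate]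
        split_ifs with h
        · rw [h, Fin.val_last, hη, pow_zero]
        · rfl
    rw [← Units.val_pow_eq_pow_val, ← Units.val_mul, hs, pow_succ', inv_mul_cancel_left,
      Units.val_pow_eq_pow_val]
  rw [traceWord_apply]
  simp only [mul_assoc, hpow]
  rw [traceWord_apply]

variable [Finite F]

theorem X_pow_sub_one_dvd_of_eval_units (f : F[X]) (hf : ∀ β : Fˣ, f.eval (β : F) = 0) :
    (X ^ (Nat.card F - 1) - 1 : F[X]) ∣ f := by
  classical
  have := Fintype.ofFinite F
  set n := Nat.card F - 1 with hn
  have hn0 : 0 < n := by have := Finite.one_lt_card (α := F); omega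
  have hmon : (X ^ n - 1 : F[X]).Monic := monic_X_pow_sub_C (1 : F) hn0.ne'
  rw [← modByMonic_eq_zero_iff_dvd hmon]
  have hcard : Fintype.card Fˣ = n := by
    rw [Fintype.card_units, hn, Nat.card_eq_fintype_card]
  refine eq_zero_of_natDegree_lt_card_of_eval_eq_zero _ (f := fun β : Fˣ => (β : F))
    Units.val_injective (fun β => ?_) ?_
  · have h1 : (β : F) ^ n = 1 := by
      rw [← hcard, ← Units.val_pow_eq_pow_val, pow_card_eq_one, Units.val_one]
    have h2 := congrArg (eval (β : F)) (modByMonic_add_div f (X ^ n - 1 : F[X]))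
    simpa [h1, hf β] using h2
  · rw [hcard]
    have hd : (X ^ n - 1 : F[X]).natDegree = n := natDegree_X_pow_sub_C (r := (1 : F))
    have := natDegree_modByMonic_lt f hmon (by rintro h; rw [h] at hd; simp at hd; omega)
    rwa [hd] at this

/-- The product vanishes at every unit `β` of `F`: at the Frobenius conjugates of `γ⁻¹` because `h`
does, elsewhere because the word polynomial is a combination of full geometric sums with ratio
different from 1. -/
theorem X_pow_sub_one_dvd_wordPoly_trace_mul {n : ℕ} (hn : n = Nat.card F - 1) (γ : Fˣ) (a : F)
    (h : k[X]) (hh : aeval ((γ⁻¹ : Fˣ) : F) h = 0) :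
    (X ^ n - 1 : k[X]) ∣ wordPoly (fun i : Fin n => Algebra.trace k F (a * (γ : F) ^ (i : ℕ))) * h
    := by
  have : Finite k := Finite.of_injective _ (algebraMap k F).injective
  have := Fintype.ofFinite k
  rw [← map_dvd_map' (algebraMap k F)]
  have hX : (X ^ n - 1 : k[X]).map (algebraMap k F) = X ^ (Nat.card F - 1) - 1 := by simp [hn]
  rw [hX]
  refine X_pow_sub_one_dvd_of_eval_units _ fun β => ?_
  rw [Polynomial.map_mul, eval_mul]
  by_cases hβ : ∃ t : ℕ, (γ : F) ^ (Nat.card k ^ t) * β = 1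
  · obtain ⟨t, ht⟩ := hβ
    have hβ' : (β : F) = ((FiniteField.frobeniusAlgHom k F) ^ t) ((γ⁻¹ : Fˣ) : F) := by
      rw [AlgHom.coe_pow, FiniteField.coe_frobeniusAlgHom, pow_iterate]
      rw [← Nat.card_eq_fintype_card, Units.val_inv_eq_inv_val]
      change (β : F) = (γ : F)⁻¹ ^ _
      rw [inv_pow]
      exact eq_inv_of_mul_eq_one_right ht
    have : eval (β : F) (h.map (algebraMap k F)) = 0 := by
      rw [eval_map_algebraMap, hβ', aeval_algHom_apply, hh, map_zero]
    rw [this, mul_zero]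
  · push Not at hβ
    have : eval (β : F) ((wordPoly (fun i : Fin n =>
        Algebra.trace k F (a * (γ : F) ^ (i : ℕ)))).map (algebraMap k F)) = 0 := by
      simp only [wordPoly, Polynomial.map_sum, Polynomial.map_mul, map_C, Polynomial.map_pow,
        map_X, eval_finsetSum, eval_mul, eval_C, eval_pow, eval_X,
        FiniteField.algebraMap_trace_eq_sum_pow, Finset.sum_mul]
      rw [Finset.sum_comm]
      refine Finset.sum_eq_zero fun t _ => ?_
      have hterm : ∀ i : Fin n, (a * (γ : F) ^ (i : ℕ)) ^ Nat.card k ^ t * (β : F) ^ (i : ℕ) =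
          a ^ Nat.card k ^ t * ((γ : F) ^ (Nat.card k ^ t) * β) ^ (i : ℕ) := by
        intro i; ring
      simp only [hterm, ← Finset.mul_sum]
      rw [Fin.sum_univ_eq_sum_range (fun i => ((γ : F) ^ (Nat.card k ^ t) * β) ^ i) n]
      set y := (γ : F) ^ (Nat.card k ^ t) * β with hy
      have hy0 : y ≠ 0 := mul_ne_zero (pow_ne_zero _ γ.ne_zero) β.ne_zero
      have hyn : y ^ n = 1 := by
        have := Fintype.ofFinite F
        rw [hn, Nat.card_eq_fintype_card]
        exact FiniteField.pow_card_sub_one_eq_one y hy0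
      rw [geom_sum_eq (hβ t), hyn, sub_self, zero_div, mul_zero]
    rw [this, zero_mul]

theorem range_traceWord_le {n : ℕ} (hn : n = Nat.card F - 1) (γ δ : Fˣ) {g h : k[X]}
    (hgh : g * h = X ^ n - 1) (hh : h ≠ 0) (hγ : aeval ((γ⁻¹ : Fˣ) : F) h = 0)
    (hδ : aeval ((δ⁻¹ : Fˣ) : F) h = 0) :
    LinearMap.range (traceWord k n γ δ) ≤ codeOfGenerator n g := by
  rintro _ ⟨v, rfl⟩
  have hsplit : traceWord k n γ δ v =
      (fun i : Fin n => Algebra.trace k F (v.1 * (γ : F) ^ (i : ℕ))) +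
      (fun i : Fin n => Algebra.trace k F (v.2 * (δ : F) ^ (i : ℕ))) := by
    ext i
    simp [traceWord_apply]
  rw [hsplit]
  refine Submodule.add_mem _ ?_ ?_ <;> rw [mem_codeOfGenerator_iff_dvd_mul hgh hh]
  · exact X_pow_sub_one_dvd_wordPoly_trace_mul hn γ _ h hγ
  · exact X_pow_sub_one_dvd_wordPoly_trace_mul hn δ _ h hδ

end Trace

/-! ### The absolute trace over the field with three elements. -/

/-- For `t ≠ 0` nondegeneracy of the trace form makes `y ↦ Tr (t y)` surjective onto `ZMod 3`, so
its kernel is a third of `K`. -/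
theorem card_trace_mul_ne_zero {K : Type*} [Field K] [Fintype K] [Algebra (ZMod 3) K]
    [DecidableEq K] {r : ℕ} (hr : Fintype.card K = 3 * r) (t : K) :
    (Finset.univ.filter fun y : K => Algebra.trace (ZMod 3) K (t * y) ≠ 0).card =
      if t = 0 then 0 else 2 * r := by
  split_ifs with ht
  · simp [ht]
  let f : K →+ ZMod 3 :=
    (Algebra.trace (ZMod 3) K).toAddMonoidHom.comp (AddMonoidHom.mulLeft t)
  have hfd : ∀ y, f y = Algebra.trace (ZMod 3) K (t * y) := fun _ => rfl
  have hf : ∃ y, f y ≠ 0 := by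
    by_contra! h
    exact ht ((traceForm_nondegenerate (ZMod 3) K).1 t h)
  obtain ⟨y, hy⟩ := hf
  have hsurj : Function.Surjective f := by
    intro c
    refine ⟨(c * (f y)⁻¹) • y, ?_⟩
    rw [hfd, mul_smul_comm, map_smul, ← hfd, smul_eq_mul, inv_mul_cancel_right₀ hy]
  have h1 := f.ker.card_mul_index
  rw [AddSubgroup.index_ker, AddMonoidHom.range_eq_top.2 hsurj, AddSubgroup.card_top,
    Nat.card_zmod, Nat.card_eq_fintype_card (α := K), hr] at h1
  have h2 : Nat.card f.ker =
      (Finset.univ.filter fun y : K => Algebra.trace (ZMod 3) K (t * y) = 0).card := by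
    rw [← Fintype.card_subtype, ← Nat.card_eq_fintype_card]
    rfl
  have h3 := Finset.card_filter_add_card_filter_not (s := (Finset.univ : Finset K))
    (fun y : K => Algebra.trace (ZMod 3) K (t * y) = 0)
  rw [Finset.card_univ, hr] at h3
  simp only [ne_eq]
  omega

theorem trace_pow_three {K : Type*} [Field K] [Finite K] [Algebra (ZMod 3) K] (x : K) :
    Algebra.trace (ZMod 3) K (x ^ 3) = Algebra.trace (ZMod 3) K x := by
  have h := Algebra.trace_eq_of_algEquiv
    (FiniteField.frobeniusAlgEquivOfAlgebraic (ZMod 3) K) x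
  rwa [FiniteField.coe_frobeniusAlgEquivOfAlgebraic, ZMod.card] at h

/-! ### Niho exponents: reduction to a cubic on each coset. -/

section Niho

variable {F : Type*} [Field F]
variable (K : Type*) [Field K] [Algebra K F] (q : ℕ) (α : Fˣ)

/-- Up to the Frobenius, `y ↦ Tr (a x + b x ^ (q + 2))` is `y ↦ Tr (t y)` on the points
`x = α ^ j * y` with `y` in the subfield `K` of order `q`, where `t` is this value. -/
noncomputable def cosetTrace (j : Fin (q + 1)) (v : F × F) : K :=
  Algebra.trace K F (v.1 ^ 3 * ((α : F) ^ (j : ℕ)) ^ 3 + v.2 * ((α : F) ^ (j : ℕ)) ^ (q + 2))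

variable [Finite F]

variable {K q α}

theorem finrank_eq_two (hq : 1 < q) (hK : Nat.card K = q) (hF : Nat.card F = q ^ 2) :
    Module.finrank K F = 2 := by
  have h := Module.natCard_eq_pow_finrank (K := K) (V := F)
  rw [hK, hF] at h
  exact (Nat.pow_right_injective hq h).symm

theorem algebraMap_trace_quadratic (hq : 1 < q) (hK : Nat.card K = q) (hF : Nat.card F = q ^ 2)
    (x : F) : algebraMap K F (Algebra.trace K F x) = x + x ^ q := by
  rw [FiniteField.algebraMap_trace_eq_sum_pow, finrank_eq_two hq hK hF, hK]
  simp [Finset.sum_range_succ]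

/-- Equality of the values for `v` and `w` on `S` gives four distinct roots of a polynomial of
degree at most 3 built from `a = v.1 - w.1` and `b = v.2 - w.2`, which must therefore be zero. -/
theorem cosetTrace_injective [CharP F 3] (hq : 1 < q) (hK : Nat.card K = q)
    (hF : Nat.card F = q ^ 2) (hα : orderOf α = q ^ 2 - 1) (S : Finset (Fin (q + 1)))
    (hS : S.card = 4) :
    Function.Injective fun (v : F × F) (j : S) => cosetTrace K q α j v := by
  have hsq : q ^ 2 - 1 = (q - 1) * (q + 1) := by
    obtain ⟨s, rfl⟩ : ∃ s, q = s + 1 := ⟨q - 1, by omega⟩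
    simp only [Nat.add_sub_cancel]
    rw [Nat.sub_eq_iff_eq_add (by nlinarith)]
    ring
  intro v w hvw
  set a := v.1 - w.1 with ha
  set b := v.2 - w.2 with hb
  have hroot : ∀ j ∈ S, a ^ 3 + b * ((α : F) ^ ((q - 1) * (j : ℕ)))
      + b ^ q * ((α : F) ^ ((q - 1) * (j : ℕ))) ^ 2
      + a ^ (3 * q) * ((α : F) ^ ((q - 1) * (j : ℕ))) ^ 3 = 0 := by
    intro j hj
    have h0 := sub_eq_zero.2 (congrFun hvw ⟨j, hj⟩)
    simp only [cosetTrace] at h0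
    set z := (α : F) ^ (j : ℕ) with hz
    have hz0 : z ≠ 0 := pow_ne_zero _ α.ne_zero
    rw [← map_sub] at h0
    have h1 := congrArg (algebraMap K F) h0
    have he : v.1 ^ 3 * z ^ 3 + v.2 * z ^ (q + 2) - (w.1 ^ 3 * z ^ 3 + w.2 * z ^ (q + 2)) =
        a ^ 3 * z ^ 3 + b * z ^ (q + 2) := by
      rw [ha, sub_pow_char, hb]
      ring
    rw [he, algebraMap_trace_quadratic hq hK hF, map_zero] at h1
    have hpow : ∀ x : F, x ^ q = algebraMap K F (Algebra.trace K F x) - x := by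
      intro x; rw [algebraMap_trace_quadratic hq hK hF]; ring
    have hadd : ∀ x y : F, (x + y) ^ q = x ^ q + y ^ q := by
      intro x y; rw [hpow, hpow, hpow]; simp only [map_add]; ring
    have hzq : z ^ (q * q) = z := by
      have := Fintype.ofFinite F
      have := FiniteField.pow_card z
      rwa [← Nat.card_eq_fintype_card, hF, sq] at this
    have hu : (α : F) ^ ((q - 1) * (j : ℕ)) = z ^ (q - 1) := by
      rw [hz, ← pow_mul, mul_comm]
    rw [hu]
    set u := z ^ (q - 1)
    have hzu : z ^ q = z * u := by
      rw [← pow_succ']; congr 1; omega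
    -- With `z^q = z u` and `(z u)^q = z`, the trace `x + x^q` of `x = z³ (a³ + b u)` becomes `z³`
    -- times the cubic in `u`.
    have hzq2 : (z * u) ^ q = z := by rw [← hzu, ← pow_mul, hzq]
    rw [hadd, mul_pow, mul_pow, pow_add, hzu] at h1
    have e1 : (z ^ 3) ^ q = (z * u) ^ 3 := by rw [← hzu]; ring
    have e2 : (z * u * z ^ 2) ^ q = z * (z * u) ^ 2 := by
      rw [mul_pow, hzq2, ← hzu]; ring
    rw [e1, e2] at h1
    have h2 : z ^ 3 * (a ^ 3 + b * u + b ^ q * u ^ 2 + a ^ (3 * q) * u ^ 3) = 0 := by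
      rw [← h1, pow_mul]; ring
    exact (mul_eq_zero.1 h2).resolve_left (pow_ne_zero _ hz0)
  have hinj : Function.Injective fun j : S => (α : F) ^ ((q - 1) * ((j : Fin (q + 1)) : ℕ)) := by
    intro i j hij
    simp only [← Units.val_pow_eq_pow_val] at hij
    have h1 := Units.ext hij
    have hlt : ∀ l : Fin (q + 1), (q - 1) * (l : ℕ) < orderOf α := by
      intro l
      rw [hα, hsq]
      exact Nat.mul_lt_mul_of_pos_left l.2 (by omega)
    have h2 := pow_injOn_Iio_orderOf (hlt i) (hlt j) h1
    exact Subtype.ext (Fin.ext (Nat.eq_of_mul_eq_mul_left (by omega) h2))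
  have hP := eq_zero_of_natDegree_lt_card_of_eval_eq_zero
    (C (a ^ (3 * q)) * X ^ 3 + C (b ^ q) * X ^ 2 + C b * X + C (a ^ 3)) hinj
    (fun j => by
      have := hroot j j.2
      simp only [eval_add, eval_mul, eval_C, eval_pow, eval_X]
      rw [← this]; ring)
    (by
      rw [Fintype.card_coe, hS]
      exact lt_of_le_of_lt natDegree_cubic_le (by norm_num))
  have ha0 : a ^ 3 = 0 := by simpa using congrArg (eval 0) hP
  have hb0 : b = 0 := by
    have h := congrArg (fun P => P.coeff 1) hP
    simpa only [coeff_add, coeff_C_mul, coeff_X_pow, coeff_X, coeff_C, coeff_zero, OfNat.one_ne_ofNat,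
      one_ne_zero, if_false, if_true, mul_zero, mul_one, zero_add, add_zero] using h
  exact Prod.ext (sub_eq_zero.1 (pow_eq_zero_iff (by norm_num) |>.1 ha0)) (sub_eq_zero.1 hb0)

theorem exists_generator_subfield (hq : 1 < q) (hK : Nat.card K = q) (hF : Nat.card F = q ^ 2)
    (hα : orderOf α = q ^ 2 - 1) :
    ∃ β : Kˣ, algebraMap K F β = (α : F) ^ (q + 1) ∧ orderOf β = q - 1 := by
  have hsq : q ^ 2 - 1 = (q + 1) * (q - 1) := by simpa using Nat.sq_sub_sq q 1
  -- The norm from `F` to `K` is `x ↦ x^(q+1)`.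
  refine ⟨Units.map (Algebra.norm K) α, ?_, ?_⟩
  · simp [FiniteField.algebraMap_norm_eq_pow_sum, finrank_eq_two hq hK hF, hK,
      Finset.sum_range_succ, add_comm]
  · rw [← orderOf_injective (Units.map (algebraMap K F : K →* F))
      (Units.map_injective (algebraMap K F).injective)]
    have : Units.map (algebraMap K F : K →* F) (Units.map (Algebra.norm K) α) = α ^ (q + 1) := by
      ext
      simp [FiniteField.algebraMap_norm_eq_pow_sum, finrank_eq_two hq hK hF, hK,
        Finset.sum_range_succ, add_comm]
    rw [this, orderOf_pow' _ (by omega), hα, hsq, Nat.gcd_eq_right (dvd_mul_right _ _),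
      Nat.mul_div_cancel_left _ (by omega)]

theorem hammingNorm_traceWord [Fintype K] [DecidableEq K] [Algebra (ZMod 3) F] [Algebra (ZMod 3) K]
    [IsScalarTower (ZMod 3) K F]
    {r : ℕ} (hr : q = 3 * r) (hq : 1 < q) (hK : Nat.card K = q) (hF : Nat.card F = q ^ 2)
    (hα : orderOf α = q ^ 2 - 1) (v : F × F) :
    hammingNorm (traceWord (ZMod 3) (q ^ 2 - 1) α (α ^ (q + 2)) v) =
      2 * r * (q + 1 - (Finset.univ.filter fun j => cosetTrace K q α j v = 0).card) := by
  have hsq : q ^ 2 - 1 = (q - 1) * (q + 1) := by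
    rw [mul_comm]; simpa using Nat.sq_sub_sq q 1
  obtain ⟨β, hβ, hβo⟩ := exists_generator_subfield hq hK hF hα
  have hKq : Fintype.card K = q := by rw [← hK, Nat.card_eq_fintype_card]
  have hcube : Function.Injective fun y : K => y ^ 3 := by
    have : CharP K 3 := charP_of_injective_algebraMap (algebraMap (ZMod 3) K).injective 3
    exact frobenius_inj K 3
  have hterm : ∀ (k : Fin (q - 1)) (j : Fin (q + 1)),
      traceWord (ZMod 3) (q ^ 2 - 1) α (α ^ (q + 2)) v
        ((finProdFinEquiv.trans (finCongr hsq.symm)) (k, j)) =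
      Algebra.trace (ZMod 3) K (cosetTrace K q α j v * ((β : K) ^ (k : ℕ)) ^ 3) := by
    intro k j
    have hi : (((finProdFinEquiv.trans (finCongr hsq.symm)) (k, j) : Fin (q ^ 2 - 1)) : ℕ) =
      j + (q + 1) * k := rfl
    rw [traceWord_apply, hi, cosetTrace]
    set y : K := (β : K) ^ (k : ℕ) with hy
    set z := (α : F) ^ (j : ℕ) with hz
    have hay : (α : F) ^ ((q + 1) * (k : ℕ)) = algebraMap K F y := by
      rw [pow_mul, ← hβ, hy, map_pow]
    have hyq : (algebraMap K F y) ^ q = algebraMap K F y := by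
      rw [← map_pow]
      congr 1
      rw [← hKq]
      exact FiniteField.pow_card y
    have e1 : (α : F) ^ ((j : ℕ) + (q + 1) * k) = z * algebraMap K F y := by
      rw [pow_add, hay]
    -- `trace_pow_three` cubes only the term in `v.1`, so that both terms carry `y³`; this factor
    -- lies in `K` and comes out of the relative trace.
    rw [Units.val_pow_eq_pow_val, ← pow_mul, mul_comm (q + 2), pow_mul, e1, mul_comm _ (y ^ 3),
      ← smul_eq_mul (y ^ 3), ← map_smul, Algebra.trace_trace, map_add, ← trace_pow_three (v.1 * _),
      ← map_add, Algebra.smul_def]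
    congr 1
    rw [mul_pow z _ (q + 2), pow_add (algebraMap K F y), hyq, map_pow (algebraMap K F) y 3]
    ring
  have hinner : ∀ j : Fin (q + 1), (Finset.univ.filter fun k : Fin (q - 1) =>
      Algebra.trace (ZMod 3) K (cosetTrace K q α j v * ((β : K) ^ (k : ℕ)) ^ 3) ≠ 0).card =
      if cosetTrace K q α j v = 0 then 0 else 2 * r := by
    intro j
    rw [← card_trace_mul_ne_zero (hKq.trans hr)]
    have hinj : Function.Injective fun k : Fin (q - 1) => β ^ (k : ℕ) := by
      intro k l hkl
      have hlt : ∀ i : Fin (q - 1), (i : ℕ) < orderOf β := fun i => i.2.trans_eq hβo.symm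
      exact Fin.ext (pow_injOn_Iio_orderOf (hlt k) (hlt l) hkl)
    have hbij : Function.Bijective fun k : Fin (q - 1) => β ^ (k : ℕ) := by
      rw [Fintype.bijective_iff_injective_and_card]
      exact ⟨hinj, by rw [Fintype.card_units, hKq, Fintype.card_fin]⟩
    have hcs : Function.Surjective fun y : K => y ^ 3 := Finite.surjective_of_injective hcube
    -- The cubes of the powers of `β` run once through the units of `K`, and `y = 0` has trace zero,
    -- so the count may be taken over all of `K`.
    refine Finset.card_bij (fun k _ => ((β : K) ^ (k : ℕ)) ^ 3) ?_ ?_ ?_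
    · intro k hk
      simpa using hk
    · intro k _ l _ hkl
      have h1 := hcube hkl
      exact hinj (Units.ext (by simpa using h1))
    · intro y hy
      have hy : Algebra.trace (ZMod 3) K (cosetTrace K q α j v * y) ≠ 0 := by simpa using hy
      obtain ⟨x, rfl⟩ := hcs y
      have hx : x ≠ 0 := by
        rintro rfl
        simp at hy
      obtain ⟨k, hk⟩ := hbij.2 (Units.mk0 x hx)
      have hk : (β : K) ^ (k : ℕ) = x := by
        rw [← Units.val_pow_eq_pow_val]
        simp only at hk
        rw [hk, Units.val_mk0]
      exact ⟨k, by simpa [hk] using hy, by simp [hk]⟩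
  rw [hammingNorm, Finset.card_filter,
    ← (finProdFinEquiv.trans (finCongr hsq.symm)).sum_comp, Fintype.sum_prod_type_right]
  simp only [hterm, ← Finset.card_filter, hinner]
  rw [Finset.sum_ite, Finset.sum_const_zero, zero_add, Finset.sum_const, smul_eq_mul, mul_comm]
  congr 1
  have h3 := Finset.card_filter_add_card_filter_not (s := (Finset.univ : Finset (Fin (q + 1))))
    (fun j => cosetTrace K q α j v = 0)
  rw [Finset.card_univ, Fintype.card_fin] at h3
  omega

end Niho

/-! ### Weight counts and minimum distance. -/

section Weights

variable {K : Type*} [Field K] [DecidableEq K] {n : ℕ}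

theorem weightCount_zero (code : Submodule K (Fin n → K)) : weightCount code 0 = 1 := by
  have : {c : Fin n → K | c ∈ code ∧ hammingNorm c = 0} = {0} := by
    ext c
    simp only [Set.mem_ofPred_eq, hammingNorm_eq_zero, Set.mem_singleton_iff]
    exact ⟨fun h => h.2, fun h => ⟨h ▸ code.zero_mem, h⟩⟩
  rw [weightCount, this, Set.ncard_singleton]

theorem weightCount_range {V : Type*} [AddCommGroup V] [Module K V] [Fintype V]
    (f : V →ₗ[K] (Fin n → K)) (hf : Function.Injective f) (w : ℕ) :
    weightCount (LinearMap.range f) w =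
      (Finset.univ.filter fun v => hammingNorm (f v) = w).card := by
  have : {c : Fin n → K | c ∈ LinearMap.range f ∧ hammingNorm c = w} =
      f '' (Finset.univ.filter fun v => hammingNorm (f v) = w : Finset V) := by
    ext c
    simp only [Set.mem_ofPred_eq, LinearMap.mem_range, Set.mem_image, Finset.coe_filter,
      Finset.mem_univ, true_and]
    constructor
    · rintro ⟨⟨v, rfl⟩, h⟩
      exact ⟨v, h, rfl⟩
    · rintro ⟨v, h, rfl⟩
      exact ⟨⟨v, rfl⟩, h⟩
  rw [weightCount, this, Set.ncard_image_of_injective _ hf, Set.ncard_coe_finset]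

theorem mem_nonzeroWeights_of_weightCount_ne_zero (code : Submodule K (Fin n → K)) {w : ℕ}
    (hw : w ≠ 0) (h : weightCount code w ≠ 0) : w ∈ nonzeroWeights code := by
  obtain ⟨c, hc, hcw⟩ := Set.nonempty_of_ncard_ne_zero h
  refine ⟨c, hc, ?_, hcw⟩
  rintro rfl
  exact hw (hcw.symm.trans hammingNorm_zero)

theorem hasParameters_of_isLeast (code : Submodule K (Fin n → K)) {k d : ℕ}
    (hk : Module.finrank K code = k) (hd : IsLeast (nonzeroWeights code) d) :
    HasParameters code k d := by
  refine ⟨hk, ?_⟩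
  convert hd using 1
  ext e
  constructor
  · rintro ⟨x, hx, y, hy, hne, he⟩
    exact ⟨x - y, code.sub_mem hx hy, sub_ne_zero.2 hne, by rw [← he, hammingDist_comm,
      hammingDist_eq_hammingNorm, neg_add_eq_sub]⟩
  · rintro ⟨c, hc, hc0, hw⟩
    exact ⟨c, hc, 0, code.zero_mem, hc0, by rw [hammingDist_zero_right, hw]⟩

end Weights

end CyclicCodes

open CyclicCodes

/-! ### Dimension and weight distribution. -/

theorem mainTheorem5 (m q : ℕ) (hm : 0 < m) (hq : q = 3 ^ m)
    (F : Type*) [Field F] [Finite F] [Algebra (ZMod 3) F] (hF : Nat.card F = q ^ 2)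
    (α : Fˣ) (hα : ∀ x : Fˣ, x ∈ Subgroup.zpowers α)
    (p : Polynomial (ZMod 3))
    (hp : p = minpoly (ZMod 3) ((α⁻¹ : Fˣ) : F) *
      minpoly (ZMod 3) (((α ^ (q + 2))⁻¹ : Fˣ) : F)) :
    (∃! code : Submodule (ZMod 3) (Fin (q ^ 2 - 1) → ZMod 3),
      CyclicCodes.HasParityCheckPolynomial code p) ∧
    ∀ code : Submodule (ZMod 3) (Fin (q ^ 2 - 1) → ZMod 3),
      CyclicCodes.HasParityCheckPolynomial code p →
      CyclicCodes.IsCyclicCode code ∧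
      CyclicCodes.HasParameters code (4 * m) (2 * q * (q - 2) / 3) ∧
      CyclicCodes.nonzeroWeights code =
        {2 * q * (q - 2) / 3, 2 * q * (q - 1) / 3, 2 * q ^ 2 / 3, 2 * q * (q + 1) / 3} ∧
      (CyclicCodes.nonzeroWeights code).ncard = 4 ∧
      CyclicCodes.weightCount code 0 = 1 ∧
      (CyclicCodes.weightCount code (2 * q * (q - 2) / 3) : ℚ) =
        ((q : ℚ) ^ 4 - (q : ℚ) ^ 3 - (q : ℚ) ^ 2 + q) / 6 ∧
      (CyclicCodes.weightCount code (2 * q * (q - 1) / 3) : ℚ) = (q : ℚ) ^ 3 - q ∧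
      (CyclicCodes.weightCount code (2 * q ^ 2 / 3) : ℚ) =
        ((q : ℚ) ^ 4 - (q : ℚ) ^ 3 + (q : ℚ) ^ 2 + q) / 2 - 1 ∧
      (CyclicCodes.weightCount code (2 * q * (q + 1) / 3) : ℚ) =
        ((q : ℚ) ^ 4 - (q : ℚ) ^ 3 - (q : ℚ) ^ 2 + q) / 3 := by
  classical
  obtain ⟨r, hr0, hr⟩ : ∃ r, 0 < r ∧ q = 3 * r :=
    ⟨3 ^ (m - 1), by positivity, by rw [hq, ← pow_succ']; congr 1; omega⟩
  have hq3 : 3 ≤ q := by omega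
  have : CharP F 3 := charP_of_injective_algebraMap (algebraMap (ZMod 3) F).injective 3
  have := Fintype.ofFinite F
  have hrank : Module.finrank (ZMod 3) F = 2 * m := by
    have h := FiniteField.pow_finrank_eq_natCard 3 F
    rw [hF, hq, ← pow_mul, mul_comm m] at h
    exact Nat.pow_right_injective (by norm_num) h
  -- The subfield of order `q` is realized by embedding `GaloisField 3 m`, possible since `m ∣ 2 *
  -- m`.
  obtain ⟨ι⟩ : Nonempty (GaloisField 3 m →ₐ[ZMod 3] F) :=
    FiniteField.nonempty_algHom_of_finrank_dvd
      (by rw [hrank, GaloisField.finrank 3 hm.ne']; exact dvd_mul_left _ _)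
  let K := GaloisField 3 m
  let _ : Algebra K F := ι.toRingHom.toAlgebra
  have : IsScalarTower (ZMod 3) K F := IsScalarTower.of_algebraMap_eq' ι.comp_algebraMap.symm
  have := Fintype.ofFinite K
  have hK : Nat.card K = q := by rw [GaloisField.card 3 m hm.ne', hq]
  set n := q ^ 2 - 1 with hn
  have hnF : n = Nat.card F - 1 := by rw [hF]
  have hn0 : 0 < n := by
    have : 3 ^ 2 ≤ q ^ 2 := Nat.pow_le_pow_left hq3 2
    omega
  have hαo : orderOf α = q ^ 2 - 1 := by
    rw [orderOf_eq_card_of_forall_mem_zpowers hα, Nat.card_units, hF]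
  obtain ⟨hle, c3, c2, c1, c0⟩ := card_zeros_distribution (cosetTrace K q α) q hq3
    (by rw [← hK, Nat.card_eq_fintype_card]) (Fintype.card_fin _)
    (by rw [Fintype.card_prod, ← Nat.card_eq_fintype_card, hF]; ring)
    (fun S hS => cosetTrace_injective (by omega) hK hF hαo S hS) 0
    (fun j => by simp [cosetTrace])
  set Z : F × F → ℕ := fun v => (Finset.univ.filter fun j => cosetTrace K q α j v = 0).card with hZ
  have hZle : ∀ v, Z v ≤ q + 1 := fun v => (Finset.card_le_univ _).trans_eq (Fintype.card_fin _)
  set Φ := traceWord (ZMod 3) n α (α ^ (q + 2)) with hΦ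
  have hwt : ∀ v, hammingNorm (Φ v) = 2 * r * (q + 1 - Z v) := fun v =>
    hammingNorm_traceWord hr (by omega) hK hF hαo v
  -- A nonzero `v` has at most three zeros among `q + 1 ≥ 4` cosets, so its word has positive
  -- weight.
  have hinj : Function.Injective Φ := by
    refine (injective_iff_map_eq_zero Φ).2 fun v hv => ?_
    by_contra hv0
    have h1 := hwt v
    rw [hv, hammingNorm_zero] at h1
    have h2 : Z v ≤ 3 := hle v hv0
    have : 0 < 2 * r * (q + 1 - Z v) := Nat.mul_pos (by omega) (by omega)
    omega
  have hfr : Module.finrank (ZMod 3) (LinearMap.range Φ) = 4 * m := by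
    rw [LinearMap.finrank_range_of_inj hinj, Module.finrank_prod, hrank]
    ring
  set p₁ := minpoly (ZMod 3) ((α⁻¹ : Fˣ) : F) with hp₁
  set p₂ := minpoly (ZMod 3) (((α ^ (q + 2))⁻¹ : Fˣ) : F) with hp₂
  have hint : ∀ x : F, IsIntegral (ZMod 3) x := fun x => Algebra.IsIntegral.isIntegral x
  have hdvd : ∀ η : Fˣ, minpoly (ZMod 3) (η : F) ∣ X ^ n - 1 := by
    intro η
    refine minpoly.dvd _ _ ?_
    have : (η : F) ^ n = 1 := by
      rw [hnF, ← Nat.card_units, ← Units.val_pow_eq_pow_val, pow_card_eq_one', Units.val_one]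
    simp [this]
  have hdeg : ∀ x : F, (minpoly (ZMod 3) x).natDegree ≤ 2 * m := fun x =>
    (minpoly.natDegree_le x).trans_eq hrank
  -- If they coincided, the `4m`-dimensional space of trace words would lie in a code of dimension
  -- at most `deg p₁ ≤ 2m`.
  have hne : p₁ ≠ p₂ := by
    intro h
    obtain ⟨g, hg⟩ := hdvd α⁻¹
    rw [mul_comm, ← hp₁] at hg
    have h1 := range_traceWord_le hnF α (α ^ (q + 2)) hg.symm (minpoly.ne_zero (hint _))
      (minpoly.aeval _ _) (by rw [h]; exact minpoly.aeval _ _)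
    have h2 := Submodule.finrank_mono h1
    have h3 := finrank_codeOfGenerator_le hn0 hg.symm
    have h4 : p₁.natDegree ≤ 2 * m := hdeg _
    rw [← hΦ, hfr] at h2
    omega
  have hpm : p.Monic := hp ▸ (minpoly.monic (hint _)).mul (minpoly.monic (hint _))
  have hpd : p ∣ X ^ n - 1 := by
    rw [hp]
    refine IsCoprime.mul_dvd ?_ (hdvd _) (hdvd _)
    rw [(minpoly.irreducible (hint _)).coprime_iff_not_dvd]
    exact fun h => hne (eq_of_monic_of_associated (minpoly.monic (hint _)) (minpoly.monic (hint _))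
      ((minpoly.irreducible (hint _)).associated_of_dvd (minpoly.irreducible (hint _)) h))
  refine ⟨existsUnique_hasParityCheckPolynomial hn0 hpm hpd, ?_⟩
  rintro code ⟨g, -, hg, hcode⟩
  have hrange : code = LinearMap.range Φ := by
    rw [hcode]
    symm
    refine Submodule.eq_of_le_of_finrank_le
      (range_traceWord_le hnF α (α ^ (q + 2)) hg hpm.ne_zero ?_ ?_) ?_
    · rw [hp, map_mul, hp₁, minpoly.aeval, zero_mul]
    · rw [hp, map_mul, hp₂, minpoly.aeval, mul_zero]
    · refine (finrank_codeOfGenerator_le hn0 hg).trans ?_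
      rw [hfr, hp, natDegree_mul (minpoly.ne_zero (hint _)) (minpoly.ne_zero (hint _))]
      exact (add_le_add (hdeg _) (hdeg _)).trans (by omega)
  -- The natural-number divisions in the statement are exact because `q = 3 * r`.
  have hw : ∀ x, 2 * q * x / 3 = 2 * r * x := by
    intro x
    rw [hr, show 2 * (3 * r) * x = 3 * (2 * r * x) by ring, Nat.mul_div_cancel_left _ (by norm_num)]
  have hw1 : 2 * q ^ 2 / 3 = 2 * r * q := by rw [← hw, sq, mul_assoc]
  rw [hw, hw, hw, hw1]
  have hcount : ∀ k ≤ 3, weightCount code (2 * r * (q + 1 - k)) =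
      (Finset.univ.filter fun v => Z v = k).card := by
    intro k hk
    rw [hrange, weightCount_range Φ hinj]
    congr 1
    ext v
    simp only [Finset.mem_filter, Finset.mem_univ, true_and]
    rw [hwt, Nat.mul_right_inj (by omega)]
    have := hZle v
    omega
  have k3 := hcount 3 le_rfl
  have k2 := hcount 2 (by norm_num)
  have k1 := hcount 1 (by norm_num)
  have k0 := hcount 0 (by norm_num)
  rw [show q + 1 - 3 = q - 2 by omega] at k3
  rw [show q + 1 - 2 = q - 1 by omega] at k2
  rw [show q + 1 - 1 = q by omega] at k1
  rw [show q + 1 - 0 = q + 1 by omega] at k0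
  replace k3 := (congrArg (Nat.cast : ℕ → ℚ) k3).trans c3
  replace k2 := (congrArg (Nat.cast : ℕ → ℚ) k2).trans c2
  replace k1 := (congrArg (Nat.cast : ℕ → ℚ) k1).trans c1
  replace k0 := (congrArg (Nat.cast : ℕ → ℚ) k0).trans c0
  have hqq : (3 : ℚ) ≤ q := by exact_mod_cast hq3
  -- Positivity of the counts shows that all four weights occur.
  have hpos : (0 : ℚ) < (q : ℚ) ^ 4 - q ^ 3 - q ^ 2 + q := by
    have : (q : ℚ) ^ 4 - q ^ 3 - q ^ 2 + q = q * (q - 1) ^ 2 * (q + 1) := by ring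
    rw [this]
    have : (0 : ℚ) < q - 1 := by linarith
    positivity
  have hmem : ∀ {w : ℕ} {x : ℚ}, 0 < w → (weightCount code w : ℚ) = x → 0 < x →
      w ∈ nonzeroWeights code := by
    intro w x hw0 hx hx0
    refine mem_nonzeroWeights_of_weightCount_ne_zero code hw0.ne' fun h => ?_
    rw [h, Nat.cast_zero] at hx
    exact hx0.ne hx
  have l1 : 2 * r * (q - 2) < 2 * r * (q - 1) := Nat.mul_lt_mul_of_pos_left (by omega) (by omega)
  have l2 : 2 * r * (q - 1) < 2 * r * q := Nat.mul_lt_mul_of_pos_left (by omega) (by omega)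
  have l3 : 2 * r * q < 2 * r * (q + 1) := Nat.mul_lt_mul_of_pos_left (by omega) (by omega)
  have l0 : 0 < 2 * r * (q - 2) := Nat.mul_pos (by omega) (by omega)
  have hset : nonzeroWeights code =
      {2 * r * (q - 2), 2 * r * (q - 1), 2 * r * q, 2 * r * (q + 1)} := by
    ext w
    simp only [Set.mem_insert_iff, Set.mem_singleton_iff]
    constructor
    · rintro ⟨c, hc, hc0, rfl⟩
      rw [hrange] at hc
      obtain ⟨v, rfl⟩ := hc
      have hv : v ≠ 0 := by
        rintro rfl
        exact hc0 (map_zero _)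
      have hz : Z v ≤ 3 := hle v hv
      rw [hwt]
      obtain h | h | h | h : Z v = 3 ∨ Z v = 2 ∨ Z v = 1 ∨ Z v = 0 := by omega
      · left; rw [h]; congr 1
      · right; left; rw [h]; congr 1
      · right; right; left; rw [h]; congr 1
      · right; right; right; rw [h]; congr 1
    · rintro (rfl | rfl | rfl | rfl)
      · exact hmem l0 k3 (by linarith)
      · exact hmem (l0.trans l1) k2 (by nlinarith)
      · exact hmem (by omega) k1 (by nlinarith)
      · exact hmem (by omega) k0 (by linarith)
  refine ⟨hrange ▸ isCyclicCode_range_traceWord hnF _ _,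
    hasParameters_of_isLeast code (hrange ▸ hfr) ?_, hset, ?_, weightCount_zero code,
    k3, k2, k1, k0⟩
  · rw [hset]
    refine ⟨by simp, fun w hw => ?_⟩
    simp only [Set.mem_insert_iff, Set.mem_singleton_iff] at hw
    omega
  · rw [hset, Set.ncard_insert_of_notMem, Set.ncard_insert_of_notMem, Set.ncard_pair] <;>
      simp <;> omega
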